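/- **Cones.** A positive cone is an $\mathbb R_{\ge 0}$-semimodule $P$ with a norm $\|\cdot\|:P\to\mathbb R_{\ge 0}$ (so $\|x\|=0\Rightarrow x=0$, $\|\lambda x\|=\lambda\|x\|$, $\|x+y\|\le\|x\|+\|y\|$) that is cancellative ($x+z=y+z\Rightarrow x=y$) and satisfies $\|x\|\le\|x+y\|$. Its order is $x\le y\iff\exists z\; x+z=y$, and $\mathcal B P=\{x\in P:\|x\|\le 1\}$. It is complete if every monotone sequence in $\mathcal B P$ has a least upper bound in $P$ and this bound lies in $\mathcal B P$. A map (on $P$ or on $\mathcal BP$) is continuous if it is monotone on $\mathcal BP$ and commutes with least upper bounds of monotone sequences of $\mathcal B P$. $P'$ is the set of linear continuous maps $P\to\mathbb R_{\ge0}$; $P$ is separated if $P'$ separates its points. For separated complete positive cones $P,Q$: * $\mathbf{SCCLin}(P,Q)$ is the set of linear continuous maps $f:P\to Q$ with $f(\mathcal B P)\subseteq\mathcal B Q$. * $\mathbf{SCCStab}(P,Q)$ is the set of stable functions of norm at most $1$: continuous functions $g:\mathcal B P\to Q$ with $g(\mathcal BP)\subseteq\mathcal BQ$ that are totally monotone,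 that is, for all $n$ and $x_1,\dots,x_n\in P$ with $\sum_i x_i\in\mathcal B P$, $$\sum_{I\subseteq\{1,\dots,n\},\ n-|I|\text{ odd}}g\Big(\sum_{i\in I}x_i\Big)\le\sum_{I\subseteq\{1,\dots,n\},\ n-|I|\text{ even}}g\Big(\sum_{i\in I}x_i\Big).$$ The exponential $!P$ is the value at $P$ of the left adjoint of the inclusion of $\mathbf{SCCLin}$ into $\mathbf{SCCStab}$, given by the special adjoint functor theorem with $\mathbb R_{\ge0}$ as cogenerator: the intersection of all the subobjects of $\prod_{h\in\mathbf{SCCStab}(P,\mathbb R_{\ge0})}\mathbb R_{\ge0}$ (product of cones: bounded families, supremum norm) through which $x\mapsto(h(x))_h$ factors as a stable function of norm at most $1$, with the supremum of the norms of these subobjects as its norm. The unit of the adjunction is the stable function $x\mapsto x^!\in{!P}$, and its bijection is $\Phi:\mathbf{SCCLin}(!P,Q)\to\mathbf{SCCStab}(P,Q)$, $\Phi(f)(x)=f(x^!)$. **Measurability.** Fix a category $\mathcal R$ with finite products and a functor $\rho$ from $\mathcal R$ to measurable spaces and measurable functions that preserves finite products. A measurable cone $P$ is a separated complete positive cone together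 with, for each $p\in\mathcal R$, a set $M^P_p$ of functions $l:\rho(p)\to P'$ (tests of arity $p$) such that $r\mapsto l(r)(x)$ is measurable for every $l\in M^P_p$ and $x\in P$, and $l\circ\rho(h)\in M^P_q$ for every $l\in M^P_p$ and every morphism $h:q\to p$. A measurable path of arity $p$ of $P$ is a map $\gamma:\rho(p)\to\mathcal B P$ such that for all $q$ and $m\in M^P_q$ the map $(r,s)\mapsto m(s)(\gamma(r))$ is measurable on $\rho(p)\times\rho(q)$. An $f\in\mathbf{SCCLin}(P,Q)$, or a $g\in\mathbf{SCCStab}(P,Q)$, is measurable if for every $p$ its composite with every measurable path of arity $p$ of $P$ is a measurable path of arity $p$ of $Q$. For a measurable cone $P$, the cone $!P$ is a measurable cone whose tests of arity $q$ are the $l:\rho(q)\to(!P)'$ such that $s\mapsto l(s)(z)$ is measurable for each $z\in{!P}$ and $(r,s)\mapsto l(s)(\gamma(r)^!)$ is measurable on $\rho(p)\times\rho(q)$ for every $p$ and every measurable path $\gamma$ of arity $p$ of $P$. **Theorem.** For all measurable cones $P$ and $Q$, the map $\Phi:\mathbf{SCCLin}(!P,Q)\to\mathbf{SCCStab}(P,Q)$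 is a bijection, and it restricts to a bijection from the measurable elements of $\mathbf{SCCLin}(!P,Q)$ to the measurable elements of $\mathbf{SCCStab}(P,Q)$. -/

import Mathlib

open scoped NNReal
open CategoryTheory

namespace MeasCones

universe u v w

/-! ## Positive cones -/

/-- The algebraic order of a commutative monoid. -/
def AlgLE {P : Type u} [AddCommMonoid P] (x y : P) : Prop := ∃ z, x + z = y

/-- `s` is a least upper bound, for the algebraic order, of the sequence `x`. -/
def IsAlgLUB {P : Type u} [AddCommMonoid P] (x : ℕ → P) (s : P) : Prop :=
  (∀ n, AlgLE (x n) s) ∧ ∀ t, (∀ n, AlgLE (x n) t) → AlgLE s t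

/-- Positive cones: cancellative `ℝ≥0`-semimodules with a norm that is monotone for the
algebraic order. -/
class PosCone (P : Type u) [AddCommMonoid P] [Module ℝ≥0 P] where
  nrm : P → ℝ≥0
  eq_zero_of_nrm : ∀ x, nrm x = 0 → x = 0
  nrm_smul : ∀ (a : ℝ≥0) (x : P), nrm (a • x) = a * nrm x
  nrm_add_le : ∀ x y, nrm (x + y) ≤ nrm x + nrm y
  cancel : ∀ x y z : P, x + z = y + z → x = y
  nrm_le_add : ∀ x y, nrm x ≤ nrm (x + y)

open PosCone

/-- The closed unit ball. -/
abbrev Ball (P : Type u) [AddCommMonoid P] [Module ℝ≥0 P] [PosCone P] : Type u :=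
  {x : P // nrm x ≤ 1}

/-- Every monotone sequence of the unit ball has a lub, which lies in the unit ball. -/
def IsCompleteCone (P : Type u) [AddCommMonoid P] [Module ℝ≥0 P] [PosCone P] : Prop :=
  ∀ x : ℕ → Ball P, (∀ n, AlgLE (x n).1 (x (n + 1)).1) →
    ∃ s : Ball P, IsAlgLUB (fun n => (x n).1) s.1

/-- Monotonicity and commutation with lubs of monotone sequences of the unit ball. -/
structure IsScottCont {P : Type u} {Q : Type v} [AddCommMonoid P] [Module ℝ≥0 P] [PosCone P]
    [AddCommMonoid Q] (f : Ball P → Q) : Prop where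
  mono : ∀ x y : Ball P, AlgLE x.1 y.1 → AlgLE (f x) (f y)
  lub : ∀ (x : ℕ → Ball P) (s : Ball P), (∀ n, AlgLE (x n).1 (x (n + 1)).1) →
    IsAlgLUB (fun n => (x n).1) s.1 → IsAlgLUB (fun n => f (x n)) (f s)

theorem nrm_zero {P : Type u} [AddCommMonoid P] [Module ℝ≥0 P] [PosCone P] :
    nrm (0 : P) = 0 := by
  have h := nrm_smul (0 : ℝ≥0) (0 : P)
  simpa using h

theorem nrm_le_of_algLE {P : Type u} [AddCommMonoid P] [Module ℝ≥0 P] [PosCone P] {x y : P}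
    (h : AlgLE x y) : nrm x ≤ nrm y := by
  obtain ⟨z, rfl⟩ := h
  exact nrm_le_add x z

theorem nrm_sum_le {P : Type u} [AddCommMonoid P] [Module ℝ≥0 P] [PosCone P] {n : ℕ}
    {x : Fin n → P} (hx : nrm (∑ i, x i) ≤ 1) (I : Finset (Fin n)) :
    nrm (∑ i ∈ I, x i) ≤ 1 := by
  refine le_trans ?_ hx
  rw [← Finset.sum_add_sum_compl I x]
  exact nrm_le_add _ _

theorem algLE_nnreal {x y : ℝ≥0} : AlgLE x y ↔ x ≤ y :=
  ⟨fun ⟨_, h⟩ => h ▸ le_self_add, fun h => ⟨y - x, add_tsub_cancel_of_le h⟩⟩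

theorem isAlgLUB_nnreal {x : ℕ → ℝ≥0} {s : ℝ≥0} :
    IsAlgLUB x s ↔ IsLUB (Set.range x) s := by
  simp only [IsAlgLUB, algLE_nnreal, isLUB_iff_le_iff, mem_upperBounds, Set.forall_mem_range]
  exact ⟨fun h b => ⟨fun hb n => (h.1 n).trans hb, h.2 b⟩,
    fun h => ⟨(h s).1 le_rfl, fun t => (h t).2⟩⟩

/-- The cone `ℝ≥0`, whose norm is the identity. -/
instance : PosCone ℝ≥0 where
  nrm x := x
  eq_zero_of_nrm _ h := h
  nrm_smul _ _ := rfl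
  nrm_add_le _ _ := le_rfl
  cancel _ _ _ h := add_right_cancel h
  nrm_le_add _ _ := le_self_add

/-- The dual of `P`: linear and continuous maps `P → ℝ≥0`. -/
structure Dual (P : Type u) [AddCommMonoid P] [Module ℝ≥0 P] [PosCone P] where
  map : P →ₗ[ℝ≥0] ℝ≥0
  cont : IsScottCont (fun x : Ball P => map x.1)

/-- Elements are separated by the dual. -/
def IsSeparatedCone (P : Type u) [AddCommMonoid P] [Module ℝ≥0 P] [PosCone P] : Prop :=
  ∀ x y : P, (∀ x' : Dual P, x'.map x = x'.map y) → x = y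

/-- Objects: separated complete positive cones. -/
structure SCC where
  carrier : Type u
  [addCommMonoid : AddCommMonoid carrier]
  [module : Module ℝ≥0 carrier]
  [posCone : PosCone carrier]
  complete : IsCompleteCone carrier
  separated : IsSeparatedCone carrier

instance : CoeSort SCC.{u} (Type u) := ⟨SCC.carrier⟩

attribute [instance] SCC.addCommMonoid SCC.module SCC.posCone

/-- Continuous linear maps of norm at most `1`. -/
structure SCCLin (P : Type u) (Q : Type v) [AddCommMonoid P] [Module ℝ≥0 P] [PosCone P]
    [AddCommMonoid Q] [Module ℝ≥0 Q] [PosCone Q] where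
  map : P →ₗ[ℝ≥0] Q
  cont : IsScottCont (fun x : Ball P => map x.1)
  nrm_le : ∀ x : P, nrm x ≤ 1 → nrm (map x) ≤ 1

/-! ## Stable functions -/

/-- Total monotonicity: for `x₁, …, xₙ` with `∑ xᵢ` in the unit ball, the sum of the
`f (∑_{i ∈ I} xᵢ)` with `n - |I|` odd is at most the one with `n - |I|` even. -/
def TotallyMonotone {P : Type u} {Q : Type v} [AddCommMonoid P] [Module ℝ≥0 P] [PosCone P]
    [AddCommMonoid Q] (f : Ball P → Q) : Prop :=
  ∀ (n : ℕ) (x : Fin n → P) (hx : nrm (∑ i, x i) ≤ 1),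
    AlgLE
      (∑ I : Finset (Fin n) with Odd (n - I.card), f ⟨∑ i ∈ I, x i, nrm_sum_le hx I⟩)
      (∑ I : Finset (Fin n) with Even (n - I.card), f ⟨∑ i ∈ I, x i, nrm_sum_le hx I⟩)

/-- Stable functions, defined on the unit ball only. -/
structure IsStable {P : Type u} {Q : Type v} [AddCommMonoid P] [Module ℝ≥0 P] [PosCone P]
    [AddCommMonoid Q] [Module ℝ≥0 Q] [PosCone Q] (f : Ball P → Q) : Prop where
  bounded : ∃ c : ℝ≥0, ∀ x, nrm (f x) ≤ c
  totallyMonotone : TotallyMonotone f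
  cont : IsScottCont f

/-- Stable functions of norm at most `1`. -/
structure SCCStab (P : Type u) (Q : Type v) [AddCommMonoid P] [Module ℝ≥0 P] [PosCone P]
    [AddCommMonoid Q] [Module ℝ≥0 Q] [PosCone Q] where
  map : Ball P → Q
  stable : IsStable map
  nrm_le : ∀ x, nrm (map x) ≤ 1

/-! ## The exponential

The left adjoint of the inclusion of linear maps into stable functions, as it is produced by
the special adjoint functor theorem: the intersection of all the subobjects of the product
cone `∏ ℝ≥0`, indexed by the stable functions `h : P → ℝ≥0` of norm at most `1`, through which
the map `x ↦ (h x)_h` factors as a stable function of norm at most `1`. -/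

section Exponential

variable (P : Type u) [AddCommMonoid P] [Module ℝ≥0 P] [PosCone P]

/-- The canonical map from the unit ball of `P` to families indexed by stable functions. -/
def evalFamily (x : Ball P) : SCCStab P ℝ≥0 → ℝ≥0 := fun h => h.map x

/-- Subobjects of the product cone `∏_h ℝ≥0` through which `evalFamily` factors. Such a
subobject has its own norm and its own (algebraic) order; its inclusion into the product is
required to be a morphism, that is, each coordinate is. -/
structure ExpSub where
  carrier : Submodule ℝ≥0 (SCCStab P ℝ≥0 → ℝ≥0)
  [posCone : PosCone carrier]
  complete : IsCompleteCone carrier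
  coord_cont : ∀ h, IsScottCont (fun z : Ball carrier => z.1.1 h)
  coord_le : ∀ (h) (z : carrier), z.1 h ≤ nrm z
  eval_mem : ∀ x, evalFamily P x ∈ carrier
  eval_stable : IsStable (fun x => (⟨evalFamily P x, eval_mem x⟩ : carrier))
  eval_le : ∀ x, nrm (⟨evalFamily P x, eval_mem x⟩ : carrier) ≤ 1

attribute [instance] ExpSub.posCone

/-- Bounded families. -/
def bddSub : Submodule ℝ≥0 (SCCStab P ℝ≥0 → ℝ≥0) where
  carrier := {z | BddAbove (Set.range z)}
  zero_mem' := ⟨0, by rintro _ ⟨h, rfl⟩; exact le_rfl⟩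
  add_mem' := by
    rintro y z ⟨c, hc⟩ ⟨d, hd⟩
    refine ⟨c + d, ?_⟩
    rintro _ ⟨h, rfl⟩
    exact add_le_add (hc ⟨h, rfl⟩) (hd ⟨h, rfl⟩)
  smul_mem' := by
    rintro a z ⟨c, hc⟩
    refine ⟨a * c, ?_⟩
    rintro _ ⟨h, rfl⟩
    exact mul_le_mul_right (hc ⟨h, rfl⟩) a

variable {P}

theorem bddSub_algLE {y z : bddSub P} : AlgLE y z ↔ ∀ h, y.1 h ≤ z.1 h := by
  constructor
  · rintro ⟨d, rfl⟩ h
    exact le_self_add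
  · intro hyz
    obtain ⟨c, hc⟩ := z.2
    refine ⟨⟨fun h => z.1 h - y.1 h, c, ?_⟩, ?_⟩
    · rintro _ ⟨h, rfl⟩
      exact tsub_le_self.trans (hc ⟨h, rfl⟩)
    · ext h : 2
      exact add_tsub_cancel_of_le (hyz h)

/-- The norm of the product cone. -/
noncomputable instance : PosCone (bddSub P) where
  nrm z := ⨆ h, z.1 h
  eq_zero_of_nrm z hz := by
    ext h : 2
    exact le_antisymm ((le_ciSup z.2 h).trans hz.le) zero_le
  nrm_smul a z := (NNReal.mul_iSup z.1 a).symm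
  nrm_add_le y z := ciSup_le' fun h => add_le_add (le_ciSup y.2 h) (le_ciSup z.2 h)
  cancel x y z h := by
    ext k : 2
    exact add_right_cancel (congrFun (congrArg Subtype.val h) k)
  nrm_le_add y z := ciSup_le' fun h => le_self_add.trans (le_ciSup (y + z).2 h)

theorem bddSub_isAlgLUB {y : ℕ → bddSub P} {z : bddSub P}
    (hz : ∀ h, IsLUB (Set.range fun n => (y n).1 h) (z.1 h)) : IsAlgLUB y z :=
  ⟨fun n => bddSub_algLE.2 fun h => (hz h).1 ⟨n, rfl⟩,
    fun t ht => bddSub_algLE.2 fun h => (hz h).2 (by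
      rintro _ ⟨n, rfl⟩
      exact bddSub_algLE.1 (ht n) h)⟩

theorem bddSub_exists_lub (y : ℕ → Ball (bddSub P)) :
    ∃ z : Ball (bddSub P), ∀ h, IsLUB (Set.range fun n => (y n).1.1 h) (z.1.1 h) := by
  have hb : ∀ h n, (y n).1.1 h ≤ 1 := fun h n => (le_ciSup (y n).1.2 h).trans (y n).2
  have hB : ∀ h, BddAbove (Set.range fun n => (y n).1.1 h) := fun h =>
    ⟨1, by rintro _ ⟨n, rfl⟩; exact hb h n⟩
  exact ⟨⟨⟨fun h => ⨆ n, (y n).1.1 h, 1, by rintro _ ⟨h, rfl⟩; exact ciSup_le' (hb h)⟩,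
    ciSup_le' fun h => ciSup_le' (hb h)⟩, fun h => isLUB_ciSup (hB h)⟩

theorem evalFamily_mono {x y : Ball P} (hxy : AlgLE x.1 y.1) (h : SCCStab P ℝ≥0) :
    evalFamily P x h ≤ evalFamily P y h :=
  algLE_nnreal.1 (h.stable.cont.mono x y hxy)

variable (P)

/-- The product cone itself, as a subobject. -/
noncomputable def ExpSub.top : ExpSub P where
  carrier := bddSub P
  complete y _ := by
    obtain ⟨z, hz⟩ := bddSub_exists_lub y
    exact ⟨z, bddSub_isAlgLUB hz⟩
  coord_cont h :=
    { mono := fun y z hyz => algLE_nnreal.2 (bddSub_algLE.1 hyz h)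
      lub := by
        intro y s hy hs
        obtain ⟨z, hz⟩ := bddSub_exists_lub y
        have h1 := bddSub_isAlgLUB (y := fun n => (y n).1) hz
        have h2 : s.1.1 h = z.1.1 h :=
          le_antisymm (bddSub_algLE.1 (hs.2 _ h1.1) h) (bddSub_algLE.1 (h1.2 _ hs.1) h)
        rw [isAlgLUB_nnreal, h2]
        exact hz h }
  coord_le h z := le_ciSup z.2 h
  eval_mem x := ⟨1, by rintro _ ⟨h, rfl⟩; exact h.nrm_le x⟩
  eval_stable :=
    { bounded := ⟨1, fun x => ciSup_le' fun h => h.nrm_le x⟩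
      totallyMonotone := by
        intro n x hx
        rw [bddSub_algLE]
        intro h
        simp only [Submodule.coe_sum, Finset.sum_apply]
        exact algLE_nnreal.1 (h.stable.totallyMonotone n x hx)
      cont :=
        { mono := fun x y hxy => bddSub_algLE.2 (evalFamily_mono hxy)
          lub := fun x s hx hs => bddSub_isAlgLUB fun h =>
            isAlgLUB_nnreal.1 (h.stable.cont.lub x s hx hs) } }
  eval_le x := ciSup_le' fun h => h.nrm_le x

/-- The underlying semimodule of the exponential: the families that belong to all the
subobjects, with bounded norms. -/
def expCarrier : Submodule ℝ≥0 (SCCStab P ℝ≥0 → ℝ≥0) where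
  carrier := {z | ∃ c : ℝ≥0, ∀ H : ExpSub P, ∃ hz : z ∈ H.carrier,
    nrm (⟨z, hz⟩ : H.carrier) ≤ c}
  zero_mem' := ⟨0, fun H => ⟨H.carrier.zero_mem, by
    have : nrm (0 : H.carrier) = 0 := nrm_zero
    exact this.le⟩⟩
  add_mem' := by
    rintro y z ⟨c, hc⟩ ⟨d, hd⟩
    refine ⟨c + d, fun H => ?_⟩
    obtain ⟨hy, hy'⟩ := hc H
    obtain ⟨hz, hz'⟩ := hd H
    exact ⟨H.carrier.add_mem hy hz,
      (nrm_add_le (⟨y, hy⟩ : H.carrier) ⟨z, hz⟩).trans (add_le_add hy' hz')⟩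
  smul_mem' := by
    rintro a z ⟨c, hc⟩
    refine ⟨a * c, fun H => ?_⟩
    obtain ⟨hz, hz'⟩ := hc H
    refine ⟨H.carrier.smul_mem a hz, ?_⟩
    have := nrm_smul a (⟨z, hz⟩ : H.carrier)
    exact this.le.trans (mul_le_mul_right hz' a)

variable {P}

/-- The element of a subobject given by an element of the exponential. -/
def expIncl (H : ExpSub P) (z : expCarrier P) : H.carrier :=
  ⟨z.1, by obtain ⟨c, hc⟩ := z.2; exact (hc H).1⟩

theorem bddAbove_expIncl (z : expCarrier P) :
    BddAbove (Set.range fun H : ExpSub P => nrm (expIncl H z)) := by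
  obtain ⟨c, hc⟩ := z.2
  exact ⟨c, by rintro _ ⟨H, rfl⟩; exact (hc H).2⟩

/-- An element of the exponential from a family that belongs to all the subobjects. -/
def expMk (z : SCCStab P ℝ≥0 → ℝ≥0) (c : ℝ≥0)
    (hz : ∀ H : ExpSub P, ∃ y : H.carrier, y.1 = z ∧ nrm y ≤ c) : expCarrier P :=
  ⟨z, c, fun H => by obtain ⟨y, rfl, hy⟩ := hz H; exact ⟨y.2, hy⟩⟩

theorem algLE_expIncl {y z : expCarrier P} (hyz : AlgLE y z) (H : ExpSub P) :
    AlgLE (expIncl H y) (expIncl H z) := by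
  obtain ⟨d, rfl⟩ := hyz
  exact ⟨expIncl H d, rfl⟩

theorem algLE_of_expIncl {y z : expCarrier P}
    (hyz : ∀ H, AlgLE (expIncl H y) (expIncl H z)) : AlgLE y z := by
  obtain ⟨d, hd⟩ := hyz (ExpSub.top P)
  have hd' : y.1 + d.1 = z.1 := congrArg Subtype.val hd
  obtain ⟨c, hc⟩ := bddAbove_expIncl z
  refine ⟨expMk d.1 c fun H => ?_, Subtype.ext hd'⟩
  obtain ⟨e, he⟩ := hyz H
  have he' : y.1 + e.1 = z.1 := congrArg Subtype.val he
  refine ⟨e, add_left_cancel (he'.trans hd'.symm), ?_⟩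
  refine (nrm_le_of_algLE ⟨expIncl H y, ?_⟩).trans (hc ⟨H, rfl⟩)
  rw [add_comm]
  exact he

/-- The exponential cone; the norm is the supremum of the norms in all the subobjects. -/
noncomputable instance : PosCone (expCarrier P) where
  nrm z := ⨆ H : ExpSub P, nrm (expIncl H z)
  eq_zero_of_nrm z hz := by
    have h0 : nrm (expIncl (ExpSub.top P) z) = 0 :=
      le_antisymm ((le_ciSup (bddAbove_expIncl z) (ExpSub.top P)).trans hz.le) zero_le
    have h1 : expIncl (ExpSub.top P) z = 0 := eq_zero_of_nrm _ h0
    have h2 : z.1 = 0 := congrArg Subtype.val h1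
    exact Subtype.ext h2
  nrm_smul a z := by
    rw [NNReal.mul_iSup]
    exact iSup_congr fun H => nrm_smul a (expIncl H z)
  nrm_add_le y z := ciSup_le' fun H => (nrm_add_le (expIncl H y) (expIncl H z)).trans
    (add_le_add (le_ciSup (bddAbove_expIncl y) H) (le_ciSup (bddAbove_expIncl z) H))
  cancel _ _ _ h := Subtype.ext (add_right_cancel (congrArg Subtype.val h))
  nrm_le_add y z := ciSup_le' fun H => (nrm_le_add (expIncl H y) (expIncl H z)).trans
    (le_ciSup (bddAbove_expIncl (y + z)) H)

theorem nrm_expIncl_le (H : ExpSub P) (z : expCarrier P) : nrm (expIncl H z) ≤ nrm z :=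
  le_ciSup (bddAbove_expIncl z) H

/-- A monotone sequence of the unit ball has a lub, which is a lub in all the subobjects. -/
theorem exp_exists_lub (y : ℕ → Ball (expCarrier P))
    (hy : ∀ n, AlgLE (y n).1 (y (n + 1)).1) :
    ∃ s : Ball (expCarrier P), IsAlgLUB (fun n => (y n).1) s.1 ∧
      ∀ h, IsAlgLUB (fun n => (y n).1.1 h) (s.1.1 h) := by
  have hyb : ∀ H n, nrm (expIncl H (y n).1) ≤ 1 := fun H n =>
    (nrm_expIncl_le H _).trans (y n).2
  have key : ∀ H : ExpSub P, ∃ s : Ball H.carrier,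
      IsAlgLUB (fun n => expIncl H (y n).1) s.1 := fun H =>
    H.complete (fun n => ⟨expIncl H (y n).1, hyb H n⟩) fun n => algLE_expIncl (hy n) H
  choose s hs using key
  have hsh : ∀ H h, IsLUB (Set.range fun n => (y n).1.1 h) ((s H).1.1 h) := fun H h =>
    isAlgLUB_nnreal.1 ((H.coord_cont h).lub (fun n => ⟨expIncl H (y n).1, hyb H n⟩) (s H)
      (fun n => algLE_expIncl (hy n) H) (hs H))
  have hst : ∀ H, (s H).1.1 = (s (ExpSub.top P)).1.1 := fun H => funext fun h =>
    (hsh H h).unique (hsh _ h)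
  let t : expCarrier P := expMk (s (ExpSub.top P)).1.1 1 fun H => ⟨(s H).1, hst H, (s H).2⟩
  have ht : ∀ H, expIncl H t = (s H).1 := fun H => Subtype.ext (hst H).symm
  refine ⟨⟨t, ciSup_le' fun H => (congrArg nrm (ht H)).le.trans (s H).2⟩, ⟨fun n => ?_,
    fun u hu => ?_⟩, fun h => isAlgLUB_nnreal.2 (hsh _ h)⟩
  · exact algLE_of_expIncl fun H => (ht H).symm ▸ (hs H).1 n
  · exact algLE_of_expIncl fun H => (ht H).symm ▸
      (hs H).2 _ fun n => algLE_expIncl (hu n) H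

theorem exp_complete : IsCompleteCone (expCarrier P) := fun y hy => by
  obtain ⟨s, hs, -⟩ := exp_exists_lub y hy
  exact ⟨s, hs⟩

/-- Coordinates are linear and continuous on the exponential. -/
def expCoord (h : SCCStab P ℝ≥0) : Dual (expCarrier P) where
  map := LinearMap.proj h ∘ₗ (expCarrier P).subtype
  cont :=
    { mono := by
        rintro y z ⟨d, hd⟩
        exact ⟨d.1 h, congrFun (congrArg Subtype.val hd) h⟩
      lub := by
        intro y s hy hs
        obtain ⟨t, ht, ht'⟩ := exp_exists_lub y hy
        have hst : s.1.1 h = t.1.1 h := by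
          obtain ⟨d, hd⟩ := hs.2 _ ht.1
          obtain ⟨e, he⟩ := ht.2 _ hs.1
          have hd' : s.1.1 h + d.1 h = t.1.1 h := congrFun (congrArg Subtype.val hd) h
          have he' : t.1.1 h + e.1 h = s.1.1 h := congrFun (congrArg Subtype.val he) h
          exact le_antisymm (hd' ▸ le_self_add) (he' ▸ le_self_add)
        have := ht' h
        rw [← hst] at this
        exact this }

theorem exp_separated : IsSeparatedCone (expCarrier P) := fun _ _ hyz =>
  Subtype.ext (funext fun h => hyz (expCoord h))

/-- Promotion, as a function to the exponential. -/
def promFun (x : Ball P) : expCarrier P :=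
  expMk (evalFamily P x) 1 fun H => ⟨⟨_, H.eval_mem x⟩, rfl, H.eval_le x⟩

theorem expIncl_sum {ι : Type*} (H : ExpSub P) (s : Finset ι) (z : ι → expCarrier P) :
    expIncl H (∑ i ∈ s, z i) = ∑ i ∈ s, expIncl H (z i) := by
  apply Subtype.ext
  simp only [expIncl, Submodule.coe_sum]

theorem nrm_promFun_le (x : Ball P) : nrm (promFun x) ≤ 1 :=
  ciSup_le' fun H => H.eval_le x

theorem promFun_stable : IsStable (promFun : Ball P → expCarrier P) where
  bounded := ⟨1, nrm_promFun_le⟩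
  totallyMonotone n x hx := algLE_of_expIncl fun H => by
    rw [expIncl_sum, expIncl_sum]
    exact H.eval_stable.totallyMonotone n x hx
  cont :=
    { mono := fun x y hxy => algLE_of_expIncl fun H => H.eval_stable.cont.mono x y hxy
      lub := fun x s hx hs =>
        ⟨fun n => algLE_of_expIncl fun H => (H.eval_stable.cont.lub x s hx hs).1 n,
          fun t ht => algLE_of_expIncl fun H => (H.eval_stable.cont.lub x s hx hs).2 _
            fun n => algLE_expIncl (ht n) H⟩ }

end Exponential

/-- The exponential `!P`. -/
noncomputable def expObj (P : SCC.{u}) : SCC.{u} where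
  carrier := expCarrier P
  complete := exp_complete
  separated := exp_separated

/-- The universal stable function `x ↦ x!` from `P` to `!P`. -/
noncomputable def prom (P : SCC.{u}) : SCCStab P (expObj P) where
  map := promFun
  stable := promFun_stable
  nrm_le := nrm_promFun_le

section Maps

variable {P : Type u} {Q : Type v} {R : Type w} [AddCommMonoid P] [Module ℝ≥0 P] [PosCone P]
  [AddCommMonoid Q] [Module ℝ≥0 Q] [PosCone Q] [AddCommMonoid R] [Module ℝ≥0 R] [PosCone R]

/-- The action of a continuous linear map of norm at most `1` on unit balls. -/
def SCCLin.onBall (f : SCCLin P Q) (x : Ball P) : Ball Q := ⟨f.map x.1, f.nrm_le x.1 x.2⟩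

/-- A stable function of norm at most `1`, as a map of unit balls. -/
def SCCStab.onBall (g : SCCStab P Q) (x : Ball P) : Ball Q := ⟨g.map x, g.nrm_le x⟩

/-- The stable function `f ∘ g`, for `f` linear and continuous. -/
def SCCLin.compStab (f : SCCLin Q R) (g : SCCStab P Q) : SCCStab P R where
  map x := f.map (g.map x)
  stable :=
    { bounded := ⟨1, fun x => f.nrm_le _ (g.nrm_le x)⟩
      totallyMonotone := by
        intro n x hx
        obtain ⟨d, hd⟩ := g.stable.totallyMonotone n x hx
        refine ⟨f.map d, ?_⟩
        rw [← map_sum, ← map_sum, ← map_add, hd]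
      cont :=
        { mono := fun x y hxy =>
            f.cont.mono (g.onBall x) (g.onBall y) (g.stable.cont.mono x y hxy)
          lub := fun x s hx hs =>
            f.cont.lub (fun n => g.onBall (x n)) (g.onBall s)
              (fun n => g.stable.cont.mono _ _ (hx n)) (g.stable.cont.lub x s hx hs) } }
  nrm_le x := f.nrm_le _ (g.nrm_le x)

end Maps

/-- The map `SCCLin(!P, Q) → SCCStab(P, Q)` that sends `f` to `x ↦ f (x!)`. -/
noncomputable def expTranspose (P : SCC.{u}) (Q : SCC.{v}) (f : SCCLin (expObj P) Q) :
    SCCStab P Q :=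
  f.compStab (prom P)

/-! ## Measurable cones -/

section Measurable

universe u₁ v₁ w₁

variable {C : Type u₁} [Category.{v₁} C]

/-- Measurable cones over the reference functor `ρ`, which sends arities to measurable spaces.
A measurability test of arity `p` is a family of elements of the dual indexed by `ρ p`. -/
structure MCone (ρ : C ⥤ MeasCat.{w₁}) where
  cone : SCC.{u}
  tests : ∀ p : C, Set (ρ.obj p → Dual cone)
  measurable_test : ∀ (p : C), ∀ l ∈ tests p, ∀ x : cone, Measurable fun r => (l r).map x
  precomp : ∀ (p q : C), ∀ l ∈ tests p, ∀ h : q ⟶ p, (fun s => l (ρ.map h s)) ∈ tests q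

variable {ρ : C ⥤ MeasCat.{w₁}}

/-- Measurable paths of arity `p`; the space of the arity `p + q` is `ρ p × ρ q`. -/
def MCone.IsPath (P : MCone.{u} ρ) (p : C) (γ : ρ.obj p → Ball P.cone) : Prop :=
  ∀ (q : C), ∀ m ∈ P.tests q,
    Measurable fun rs : ρ.obj p × ρ.obj q => (m rs.2).map (γ rs.1).1

/-- Measurability of a linear map `P → Q`: it preserves measurable paths. -/
def IsMeasLin (P : MCone.{u} ρ) (Q : MCone.{v} ρ) (f : SCCLin P.cone Q.cone) : Prop :=
  ∀ (p : C) (γ : ρ.obj p → Ball P.cone), P.IsPath p γ → Q.IsPath p (f.onBall ∘ γ)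

/-- Measurability of a stable function `P → Q`: it preserves measurable paths. -/
def IsMeasStab (P : MCone.{u} ρ) (Q : MCone.{v} ρ) (g : SCCStab P.cone Q.cone) : Prop :=
  ∀ (p : C) (γ : ρ.obj p → Ball P.cone), P.IsPath p γ → Q.IsPath p (g.onBall ∘ γ)

/-- The measurable cone `!P`: its tests are those that are measurable at each element, and
jointly measurable along the promotion of each measurable path. -/
noncomputable def MCone.exp (P : MCone.{u} ρ) : MCone.{u} ρ where
  cone := expObj P.cone
  tests q := {l | (∀ z : expObj P.cone, Measurable fun s => (l s).map z) ∧
    ∀ (p : C) (γ : ρ.obj p → Ball P.cone), P.IsPath p γ →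
      Measurable fun rs : ρ.obj p × ρ.obj q => (l rs.2).map ((prom P.cone).map (γ rs.1))}
  measurable_test _ _ hl := hl.1
  precomp _ _ _ hl h :=
    ⟨fun z => (hl.1 z).comp (ρ.map h).2, fun p γ hγ =>
      (hl.2 p γ hγ).comp (measurable_fst.prodMk ((ρ.map h).2.comp measurable_snd))⟩

end Measurable

end MeasCones

universe u₁ v₁ w₁ u v

namespace MeasCones

open PosCone

universe w

/-! ### Uniqueness of least upper bounds, boundedness of functionals, separation by morphisms. -/

section Order

variable {P : Type u} {Q : Type v} {R : Type w} [AddCommMonoid P] [Module ℝ≥0 P] [PosCone P]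
  [AddCommMonoid Q] [Module ℝ≥0 Q] [PosCone Q] [AddCommMonoid R] [Module ℝ≥0 R] [PosCone R]

/-! The universal property of `!P` follows from its minimality: it is contained in every complete
subobject of `∏_h ℝ≥0` through which `x ↦ (h x)_h` factors stably with norm at most `1`. It
therefore suffices to exhibit suitable subobjects. Each is a joint equalizer of functionals on a
complete cone, embedded in the product by an injective morphism; `exists_lift_of_injective` turns
such an embedding into a morphism out of `!P`.

Injectivity of `Φ`: if `f` and `g` agree at all promotions, then the part of `!P` on which `y ∘ f =
y ∘ g` for every `y` in the dual of `Q` is such a subobject, hence all of `!P`, and separatedness of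
`Q` gives `f = g`.

Surjectivity: given `g`, consider the pairs `(z, q)` in the product of `∏_h ℝ≥0` and `Q` with `z (y
∘ g) = y q` for every morphism `y : Q → ℝ≥0`. Morphisms of norm at most `1` separate `Q`, because
functionals on a complete cone are bounded and can be rescaled; so `z` determines `q`, and the first
projection is injective. Evaluation factors through `x ↦ (ev x, g x)`. The resulting morphism out of
`!P`, followed by the second projection, extends `g`.

Measurability: the tests of `!P` make promotion measurable, which gives one direction. Conversely,
if `f ∘ prom` is measurable, every test of `Q` composed with `f` is a test of `!P`, so `f` preserves
measurable paths. -/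

theorem algLE_antisymm {x y : P} (hxy : AlgLE x y) (hyx : AlgLE y x) : x = y := by
  obtain ⟨a, rfl⟩ := hxy
  obtain ⟨b, hb⟩ := hyx
  -- Going up by `a` and back by `b` adds nothing, so cancellation gives `a + b = 0`, and
  -- monotonicity of the norm kills `a`.
  have hab : a + b = 0 := cancel _ _ x (by rw [zero_add, add_comm, ← add_assoc, hb])
  have ha : nrm a = 0 := le_antisymm ((nrm_le_add a b).trans (by rw [hab, nrm_zero])) zero_le
  rw [eq_zero_of_nrm a ha, add_zero]

theorem IsAlgLUB.unique {x : ℕ → P} {s t : P} (hs : IsAlgLUB x s) (ht : IsAlgLUB x t) : s = t :=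
  algLE_antisymm (hs.2 _ ht.1) (ht.2 _ hs.1)

theorem AlgLE.map {P : Type u} {Q : Type v} [AddCommMonoid P] [Module ℝ≥0 P] [AddCommMonoid Q]
    [Module ℝ≥0 Q] {x y : P} (h : AlgLE x y) (f : P →ₗ[ℝ≥0] Q) : AlgLE (f x) (f y) := by
  obtain ⟨z, rfl⟩ := h
  exact ⟨f z, (map_add f x z).symm⟩

/-- Composition of morphisms. -/
def SCCLin.comp (f : SCCLin Q R) (g : SCCLin P Q) : SCCLin P R where
  map := f.map ∘ₗ g.map
  cont :=
    { mono := fun _ _ h => h.map (f.map ∘ₗ g.map)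
      lub := fun x s hx hs => f.cont.lub (fun n => g.onBall (x n)) (g.onBall s)
        (fun n => (hx n).map g.map) (g.cont.lub x s hx hs) }
  nrm_le x hx := f.nrm_le _ (g.nrm_le x hx)

/-- Precomposition of an element of the dual with a morphism. -/
def Dual.comp (f : Dual Q) (g : SCCLin P Q) : Dual P where
  map := f.map ∘ₗ g.map
  cont :=
    { mono := fun _ _ h => h.map (f.map ∘ₗ g.map)
      lub := fun x s hx hs => f.cont.lub (fun n => g.onBall (x n)) (g.onBall s)
        (fun n => (hx n).map g.map) (g.cont.lub x s hx hs) }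

/-- On a complete cone, linear functionals are bounded. -/
theorem exists_bound_of_linear (hP : IsCompleteCone P) (f : P →ₗ[ℝ≥0] ℝ≥0) :
    ∃ c : ℝ≥0, ∀ x, nrm x ≤ 1 → f x ≤ c := by
  by_contra! h
  -- The factor `2 ^ (n + 1)` offsets the weight `w n` below: the weighted sums stay in the unit
  -- ball, while their `n`-th term alone contributes at least `n` to the value at the lub.
  -- Positivity makes `f` monotone, so continuity is not needed.
  choose x hx hfx using fun n : ℕ => h (2 ^ (n + 1) * n)
  let w : ℕ → ℝ≥0 := fun k => (2⁻¹) ^ (k + 1)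
  let S : ℕ → P := fun n => ∑ k ∈ Finset.range n, w k • x k
  have hw : ∀ n, ∑ k ∈ Finset.range n, w k + 2⁻¹ ^ n = 1 := by
    intro n
    induction n with
    | zero => simp
    | succ n ih =>
      rw [Finset.sum_range_succ, add_assoc, ← two_mul, show 2 * w n = 2⁻¹ ^ n by
        simp only [w]
        rw [pow_succ', ← mul_assoc, mul_inv_cancel₀ two_ne_zero, one_mul], ih]
  have hS : ∀ n, nrm (S n) ≤ ∑ k ∈ Finset.range n, w k := by
    intro n
    induction n with
    | zero => simp [S, nrm_zero]
    | succ n ih =>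
      simp only [S, Finset.sum_range_succ]
      refine (nrm_add_le _ _).trans (add_le_add ih ?_)
      rw [nrm_smul]
      exact mul_le_of_le_one_right zero_le (hx n)
  have hmono : ∀ n, AlgLE (S n) (S (n + 1)) := fun n =>
    ⟨w n • x n, (Finset.sum_range_succ _ n).symm⟩
  obtain ⟨s, hs⟩ := hP (fun n => ⟨S n, (hS n).trans (le_self_add.trans (hw n).le)⟩) hmono
  have hn : ∀ n : ℕ, (n : ℝ≥0) ≤ f s.1 := by
    intro n
    have h1 : f (S (n + 1)) ≤ f s.1 := algLE_nnreal.1 ((hs.1 (n + 1)).map f)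
    have h2 : f (w n • x n) ≤ f (S (n + 1)) := by
      simp only [S, Finset.sum_range_succ, map_add]
      exact le_add_self
    have h3 : (n : ℝ≥0) ≤ f (w n • x n) := by
      rw [map_smul, smul_eq_mul]
      calc (n : ℝ≥0) = w n * (2 ^ (n + 1) * n) := by
            simp only [w]
            rw [← mul_assoc, ← mul_pow, inv_mul_cancel₀ two_ne_zero, one_pow, one_mul]
        _ ≤ w n * f (x n) := mul_le_mul_right (hfx n).le _
    exact h3.trans (h2.trans h1)
  obtain ⟨n, hlt⟩ := exists_nat_gt (f s.1)
  exact absurd (hn n) (not_le.2 hlt)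

theorem isScottCont_smul {x : Dual P} (a : ℝ≥0) :
    IsScottCont (fun z : Ball P => (a • x.map) z.1) where
  mono _ _ h := h.map (a • x.map)
  lub y s hy hs := by
    refine ⟨fun n => (hs.1 n).map (a • x.map), fun t ht => ?_⟩
    have hlub := isAlgLUB_nnreal.1 (x.cont.lub y s hy hs)
    rw [algLE_nnreal]
    rcases eq_or_ne a 0 with rfl | ha
    · simp
    · have : x.map s.1 ≤ a⁻¹ * t := hlub.2 (by
        rintro _ ⟨n, rfl⟩
        have := algLE_nnreal.1 (ht n)
        simp only [LinearMap.smul_apply, smul_eq_mul] at this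
        rwa [le_inv_mul_iff₀ (pos_iff_ne_zero.2 ha)])
      simp only [LinearMap.smul_apply, smul_eq_mul]
      rwa [le_inv_mul_iff₀ (pos_iff_ne_zero.2 ha)] at this

/-- In a separated complete cone, morphisms to `ℝ≥0` separate the elements. -/
theorem eq_of_forall_sccLin (hP : IsCompleteCone P) (hP' : IsSeparatedCone P) {x y : P}
    (h : ∀ f : SCCLin P ℝ≥0, f.map x = f.map y) : x = y := by
  -- Elements of the dual carry no norm bound, so `f` is rescaled to norm at most `1`; dividing by
  -- `c + 1` rather than `c` avoids a zero denominator.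
  refine hP' x y fun f => ?_
  obtain ⟨c, hc⟩ := exists_bound_of_linear hP f.map
  have hc0 : c + 1 ≠ 0 := by positivity
  have hle : ∀ z, nrm z ≤ 1 → (c + 1)⁻¹ * f.map z ≤ 1 := fun z hz => by
    rw [inv_mul_le_iff₀ (pos_iff_ne_zero.2 hc0), mul_one]
    exact (hc z hz).trans le_self_add
  have := h { map := (c + 1)⁻¹ • f.map, cont := isScottCont_smul _, nrm_le := hle }
  exact mul_left_cancel₀ (inv_ne_zero hc0) this

end Order

/-! ### Joint equalizers of continuous functionals. -/

section Equalizer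

variable {K : Type v} [AddCommMonoid K] [Module ℝ≥0 K] [PosCone K] {ι : Type w}

/-- The joint equalizer of two families of continuous functionals. -/
def equalizer (a b : ι → Dual K) : Submodule ℝ≥0 K where
  carrier := {x | ∀ i, (a i).map x = (b i).map x}
  zero_mem' i := by simp
  add_mem' hx hy i := by rw [map_add, map_add, hx i, hy i]
  smul_mem' c x hx i := by rw [map_smul, map_smul, hx i]

variable {a b : ι → Dual K}

/-- The norm of an equalizer is the restriction of the ambient norm. -/
instance : PosCone (equalizer a b) where
  nrm x := nrm x.1
  eq_zero_of_nrm x hx := Subtype.ext (eq_zero_of_nrm x.1 hx)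
  nrm_smul c x := nrm_smul c x.1
  nrm_add_le x y := nrm_add_le x.1 y.1
  cancel x y z h := Subtype.ext (cancel x.1 y.1 z.1 (congrArg Subtype.val h))
  nrm_le_add x y := nrm_le_add x.1 y.1

/-- By cancellation in `ℝ≥0`, the difference of two members is again a member. Hence lubs and total
monotonicity can be tested in the ambient cone. -/
theorem equalizer_algLE {x y : equalizer a b} : AlgLE x y ↔ AlgLE x.1 y.1 := by
  refine ⟨fun h => h.map (equalizer a b).subtype, ?_⟩
  rintro ⟨d, hd⟩
  refine ⟨⟨d, fun i => ?_⟩, Subtype.ext hd⟩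
  have hx := x.2 i
  have hy := y.2 i
  rw [← hd, map_add, map_add, hx] at hy
  exact add_left_cancel hy

theorem equalizer_isAlgLUB {x : ℕ → equalizer a b} {s : equalizer a b}
    (h : IsAlgLUB (fun n => (x n).1) s.1) : IsAlgLUB x s :=
  ⟨fun n => equalizer_algLE.2 (h.1 n),
    fun _ ht => equalizer_algLE.2 (h.2 _ fun n => equalizer_algLE.1 (ht n))⟩

theorem equalizer_exists_lub (hK : IsCompleteCone K) (x : ℕ → Ball (equalizer a b))
    (hx : ∀ n, AlgLE (x n).1 (x (n + 1)).1) :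
    ∃ s : Ball (equalizer a b), IsAlgLUB (fun n => (x n).1.1) s.1.1 := by
  let y : ℕ → Ball K := fun n => ⟨(x n).1.1, (x n).2⟩
  have hy : ∀ n, AlgLE (y n).1 (y (n + 1)).1 := fun n => equalizer_algLE.1 (hx n)
  obtain ⟨s, hs⟩ := hK y hy
  -- The two functionals agree along the sequence, hence at its ambient lub, which therefore lies in
  -- the equalizer.
  refine ⟨⟨⟨s.1, fun i => ((a i).cont.lub y s hy hs).unique ?_⟩, s.2⟩, hs⟩
  have h := (b i).cont.lub y s hy hs
  rwa [show (fun n => (b i).map (y n).1) = fun n => (a i).map (y n).1 from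
    funext fun n => ((x n).1.2 i).symm] at h

theorem equalizer_complete (hK : IsCompleteCone K) : IsCompleteCone (equalizer a b) :=
  fun x hx => by
    obtain ⟨s, hs⟩ := equalizer_exists_lub hK x hx
    exact ⟨s, equalizer_isAlgLUB hs⟩

/-- The inclusion of an equalizer. -/
def equalizerIncl (hK : IsCompleteCone K) (a b : ι → Dual K) : SCCLin (equalizer a b) K where
  map := (equalizer a b).subtype
  cont :=
    { mono := fun _ _ h => h.map (equalizer a b).subtype
      lub := fun x s hx hs => by
        obtain ⟨t, ht⟩ := equalizer_exists_lub hK x hx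
        -- `s` is only known to be a lub within the equalizer; uniqueness identifies it with the
        -- ambient one.
        rw [hs.unique (equalizer_isAlgLUB ht)]
        exact ht }
  nrm_le _ h := h

theorem isStable_equalizer {P : Type u} [AddCommMonoid P] [Module ℝ≥0 P] [PosCone P]
    {f : Ball P → equalizer a b} (hf : IsStable fun x => (f x).1) : IsStable f where
  bounded := hf.bounded
  totallyMonotone n x hx := by
    rw [equalizer_algLE, Submodule.coe_sum, Submodule.coe_sum]
    exact hf.totallyMonotone n x hx
  cont :=
    { mono := fun x y h => equalizer_algLE.2 (hf.cont.mono x y h)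
      lub := fun x s hx hs => equalizer_isAlgLUB (hf.cont.lub x s hx hs) }

end Equalizer

/-! ### Binary products of cones. -/

section Product

variable {A : Type u} {B : Type v} [AddCommMonoid A] [Module ℝ≥0 A] [PosCone A]
  [AddCommMonoid B] [Module ℝ≥0 B] [PosCone B]

/-- The product of two cones. -/
instance : PosCone (A × B) where
  nrm x := max (nrm x.1) (nrm x.2)
  eq_zero_of_nrm x hx := Prod.ext
    (eq_zero_of_nrm x.1 (le_antisymm ((le_max_left _ _).trans hx.le) zero_le))
    (eq_zero_of_nrm x.2 (le_antisymm ((le_max_right _ _).trans hx.le) zero_le))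
  nrm_smul c x := by
    simp only [Prod.smul_fst, Prod.smul_snd, nrm_smul]
    exact (mul_max_of_nonneg _ _ zero_le).symm
  nrm_add_le x y := max_le
    ((nrm_add_le x.1 y.1).trans (add_le_add (le_max_left _ _) (le_max_left _ _)))
    ((nrm_add_le x.2 y.2).trans (add_le_add (le_max_right _ _) (le_max_right _ _)))
  cancel x y z h := Prod.ext (cancel x.1 y.1 z.1 (congrArg Prod.fst h))
    (cancel x.2 y.2 z.2 (congrArg Prod.snd h))
  nrm_le_add x y := max_le_max (nrm_le_add x.1 y.1) (nrm_le_add x.2 y.2)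

theorem prod_algLE {A : Type u} {B : Type v} [AddCommMonoid A] [AddCommMonoid B] {x y : A × B} : AlgLE x y ↔ AlgLE x.1 y.1 ∧ AlgLE x.2 y.2 := by
  constructor
  · rintro ⟨d, rfl⟩
    exact ⟨⟨d.1, rfl⟩, ⟨d.2, rfl⟩⟩
  · rintro ⟨⟨d, hd⟩, ⟨e, he⟩⟩
    exact ⟨(d, e), Prod.ext hd he⟩

theorem prod_isAlgLUB {A : Type u} {B : Type v} [AddCommMonoid A] [AddCommMonoid B]
    {x : ℕ → A × B} {s : A × B}
    (h₁ : IsAlgLUB (fun n => (x n).1) s.1)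
    (h₂ : IsAlgLUB (fun n => (x n).2) s.2) : IsAlgLUB x s :=
  ⟨fun n => prod_algLE.2 ⟨h₁.1 n, h₂.1 n⟩, fun _ ht => prod_algLE.2
    ⟨h₁.2 _ fun n => (prod_algLE.1 (ht n)).1, h₂.2 _ fun n => (prod_algLE.1 (ht n)).2⟩⟩

theorem prod_exists_lub (hA : IsCompleteCone A) (hB : IsCompleteCone B) (x : ℕ → Ball (A × B))
    (hx : ∀ n, AlgLE (x n).1 (x (n + 1)).1) :
    ∃ s : Ball (A × B), IsAlgLUB (fun n => (x n).1.1) s.1.1 ∧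
      IsAlgLUB (fun n => (x n).1.2) s.1.2 := by
  obtain ⟨s, hs⟩ := hA (fun n => ⟨(x n).1.1, (le_max_left _ _).trans (x n).2⟩)
    fun n => (prod_algLE.1 (hx n)).1
  obtain ⟨t, ht⟩ := hB (fun n => ⟨(x n).1.2, (le_max_right _ _).trans (x n).2⟩)
    fun n => (prod_algLE.1 (hx n)).2
  exact ⟨⟨(s.1, t.1), max_le s.2 t.2⟩, hs, ht⟩

theorem prod_complete (hA : IsCompleteCone A) (hB : IsCompleteCone B) :
    IsCompleteCone (A × B) := fun x hx => by
  obtain ⟨s, h₁, h₂⟩ := prod_exists_lub hA hB x hx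
  exact ⟨s, prod_isAlgLUB h₁ h₂⟩

/-- The first projection. -/
def prodFst (hA : IsCompleteCone A) (hB : IsCompleteCone B) : SCCLin (A × B) A where
  map := LinearMap.fst ℝ≥0 A B
  cont :=
    { mono := fun _ _ h => h.map (LinearMap.fst ℝ≥0 A B)
      lub := fun x s hx hs => by
        obtain ⟨t, h₁, h₂⟩ := prod_exists_lub hA hB x hx
        rw [hs.unique (prod_isAlgLUB h₁ h₂)]
        exact h₁ }
  nrm_le _ h := (le_max_left _ _).trans h

/-- The second projection. -/
def prodSnd (hA : IsCompleteCone A) (hB : IsCompleteCone B) : SCCLin (A × B) B where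
  map := LinearMap.snd ℝ≥0 A B
  cont :=
    { mono := fun _ _ h => h.map (LinearMap.snd ℝ≥0 A B)
      lub := fun x s hx hs => by
        obtain ⟨t, h₁, h₂⟩ := prod_exists_lub hA hB x hx
        rw [hs.unique (prod_isAlgLUB h₁ h₂)]
        exact h₂ }
  nrm_le _ h := (le_max_right _ _).trans h

theorem isStable_prod {P : Type w} [AddCommMonoid P] [Module ℝ≥0 P] [PosCone P]
    {f : Ball P → A} {g : Ball P → B} (hf : IsStable f) (hg : IsStable g) :
    IsStable fun x => (f x, g x) where
  bounded := by
    obtain ⟨c, hc⟩ := hf.bounded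
    obtain ⟨d, hd⟩ := hg.bounded
    exact ⟨max c d, fun x => max_le_max (hc x) (hd x)⟩
  totallyMonotone n x hx := by
    rw [prod_algLE, Prod.fst_sum, Prod.fst_sum, Prod.snd_sum, Prod.snd_sum]
    exact ⟨hf.totallyMonotone n x hx, hg.totallyMonotone n x hx⟩
  cont :=
    { mono := fun x y h => prod_algLE.2 ⟨hf.cont.mono x y h, hg.cont.mono x y h⟩
      lub := fun x s hx hs => prod_isAlgLUB (hf.cont.lub x s hx hs) (hg.cont.lub x s hx hs) }

end Product

/-! ### Subobjects of the product cone from injective morphisms. -/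

section Subobjects

variable {P : Type u} [AddCommMonoid P] [Module ℝ≥0 P] [PosCone P]
  {K : Type v} [AddCommMonoid K] [Module ℝ≥0 K] [PosCone K]

/-- The cone structure on the range of an injective linear map. -/
noncomputable abbrev rangePosCone {M : Type w} [AddCommMonoid M] [Module ℝ≥0 M] (i : K →ₗ[ℝ≥0] M)
    (hi : Function.Injective i) : PosCone (LinearMap.range i) :=
  let e := LinearEquiv.ofInjective i hi
  -- The norm is transported from `K`, since a subobject need not carry the supremum norm.
  { nrm := fun z => nrm (e.symm z)
    eq_zero_of_nrm := fun z hz => e.symm.map_eq_zero_iff.1 (eq_zero_of_nrm _ hz)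
    nrm_smul := fun c z => by rw [map_smul, nrm_smul]
    nrm_add_le := fun y z => by rw [map_add]; exact nrm_add_le _ _
    cancel := fun x y z h => e.symm.injective
      (cancel _ _ (e.symm z) (by rw [← map_add, ← map_add, h]))
    nrm_le_add := fun y z => by rw [map_add]; exact nrm_le_add _ _ }

theorem algLE_equiv {A : Type*} {B : Type*} [AddCommMonoid A] [Module ℝ≥0 A] [AddCommMonoid B]
    [Module ℝ≥0 B] (e : A ≃ₗ[ℝ≥0] B) {x y : A} : AlgLE (e x) (e y) ↔ AlgLE x y := by
  constructor
  · rintro ⟨d, hd⟩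
    exact ⟨e.symm d, e.injective (by rw [map_add, e.apply_symm_apply, hd])⟩
  · rintro ⟨d, rfl⟩
    exact ⟨e d, (map_add e x d).symm⟩

theorem isAlgLUB_equiv {A : Type*} {B : Type*} [AddCommMonoid A] [Module ℝ≥0 A]
    [AddCommMonoid B] [Module ℝ≥0 B] (e : A ≃ₗ[ℝ≥0] B) {x : ℕ → A} {s : A} :
    IsAlgLUB (fun n => e (x n)) (e s) ↔ IsAlgLUB x s := by
  simp only [IsAlgLUB, algLE_equiv]
  refine and_congr_right fun _ => ⟨fun h t ht => ?_, fun h t ht => ?_⟩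
  · exact (algLE_equiv e).1 (h _ fun n => (algLE_equiv e).2 (ht n))
  · rw [← e.apply_symm_apply t, algLE_equiv]
    refine h _ fun n => (algLE_equiv e).1 ?_
    rw [e.apply_symm_apply]
    exact ht n

/-- A complete cone with an injective morphism to the product cone, through which the evaluation
map factors, is a subobject. -/
noncomputable def ExpSub.ofInjective (hK : IsCompleteCone K) (i : K →ₗ[ℝ≥0] (SCCStab P ℝ≥0 → ℝ≥0))
    (hi : Function.Injective i) (cont : ∀ h, IsScottCont fun z : Ball K => i z.1 h)
    (le : ∀ h z, i z h ≤ nrm z) (f : SCCStab P K) (hf : ∀ x, i (f.map x) = evalFamily P x) :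
    ExpSub P :=
  letI := rangePosCone i hi
  let e := LinearEquiv.ofInjective i hi
  have he : ∀ z, (e z).1 = i z := fun _ => rfl
  have hsymm : ∀ z, i (e.symm z) = z.1 := fun z => by rw [← he, e.apply_symm_apply]
  have hmem : ∀ x, evalFamily P x ∈ LinearMap.range i := fun x => ⟨f.map x, hf x⟩
  have hev : (fun x => (⟨evalFamily P x, hmem x⟩ : LinearMap.range i)) = fun x => e (f.map x) :=
    funext fun x => Subtype.ext (hf x).symm
  { carrier := LinearMap.range i
    posCone := rangePosCone i hi
    complete := fun y hy => by
      obtain ⟨s, hs⟩ := hK (fun n => ⟨e.symm (y n).1, (y n).2⟩)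
        fun n => (algLE_equiv e.symm).2 (hy n)
      refine ⟨⟨e s.1, ?_⟩, ?_⟩
      · change nrm (e.symm (e s.1)) ≤ 1
        rw [e.symm_apply_apply]
        exact s.2
      · rw [← isAlgLUB_equiv e.symm]
        simpa using hs
    coord_cont := fun h =>
      { mono := fun y z hyz => hyz.map (Q := ℝ≥0)
          (LinearMap.proj h ∘ₗ (LinearMap.range i).subtype)
        lub := fun y s hy hs => by
          have := (cont h).lub (fun n => ⟨e.symm (y n).1, (y n).2⟩) ⟨e.symm s.1, s.2⟩
            (fun n => (algLE_equiv e.symm).2 (hy n)) ((isAlgLUB_equiv e.symm).2 hs)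
          simpa only [hsymm] using this }
    coord_le := fun h z => by
      rw [← hsymm]
      exact le h _
    eval_mem := hmem
    eval_stable := by
      rw [hev]
      exact
        { bounded := ⟨1, fun x => by
            change nrm (e.symm (e (f.map x))) ≤ 1
            rw [e.symm_apply_apply]
            exact f.nrm_le x⟩
          totallyMonotone := fun n x hx => by
            rw [← map_sum, ← map_sum, algLE_equiv]
            exact f.stable.totallyMonotone n x hx
          cont :=
            { mono := fun x y h => (algLE_equiv e).2 (f.stable.cont.mono x y h)
              lub := fun x s hx hs => (isAlgLUB_equiv e).2 (f.stable.cont.lub x s hx hs) } }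
    eval_le := fun x => by
      rw [congrFun hev x]
      change nrm (e.symm (e (f.map x))) ≤ 1
      rw [e.symm_apply_apply]
      exact f.nrm_le x }

/-- The morphism from the exponential to a subobject. -/
def expInclLin (H : ExpSub P) : SCCLin (expCarrier P) H.carrier where
  map :=
    { toFun := expIncl H
      map_add' := fun _ _ => rfl
      map_smul' := fun _ _ => rfl }
  cont :=
    { mono := fun _ _ h => algLE_expIncl h H
      lub := fun y s hy hs => by
        have hb : ∀ n, nrm (expIncl H (y n).1) ≤ 1 := fun n =>
          (nrm_expIncl_le H _).trans (y n).2
        obtain ⟨t, ht⟩ := H.complete (fun n => ⟨expIncl H (y n).1, hb n⟩)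
          fun n => algLE_expIncl (hy n) H
        -- Elements of `H` are determined by their coordinates, which commute with lubs both on the
        -- exponential and on `H`.
        have hst : expIncl H s.1 = t.1 := Subtype.ext (funext fun h =>
          ((expCoord h).cont.lub y s hy hs).unique ((H.coord_cont h).lub
            (fun n => ⟨expIncl H (y n).1, hb n⟩) t (fun n => algLE_expIncl (hy n) H) ht))
        change IsAlgLUB (fun n => expIncl H (y n).1) (expIncl H s.1)
        rw [hst]
        exact ht }
  nrm_le z hz := (nrm_expIncl_le H z).trans hz

/-- The isomorphism from a subobject given by an injective morphism to its source. -/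
noncomputable def rangeLin (i : K →ₗ[ℝ≥0] (SCCStab P ℝ≥0 → ℝ≥0)) (hi : Function.Injective i) :
    letI := rangePosCone i hi
    SCCLin (LinearMap.range i) K :=
  letI := rangePosCone i hi
  { map := (LinearEquiv.ofInjective i hi).symm.toLinearMap
    cont :=
      { mono := fun _ _ h => (algLE_equiv (LinearEquiv.ofInjective i hi).symm).2 h
        lub := fun _ _ _ hs => (isAlgLUB_equiv (LinearEquiv.ofInjective i hi).symm).2 hs }
    nrm_le := fun _ h => h }

/-- A complete cone with an injective morphism to the product cone, through which the evaluation
map factors, receives a morphism from the exponential. -/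
theorem exists_lift_of_injective (hK : IsCompleteCone K)
    (i : K →ₗ[ℝ≥0] (SCCStab P ℝ≥0 → ℝ≥0)) (hi : Function.Injective i)
    (cont : ∀ h, IsScottCont fun z : Ball K => i z.1 h) (le : ∀ h z, i z h ≤ nrm z)
    (f : SCCStab P K) (hf : ∀ x, i (f.map x) = evalFamily P x) :
    ∃ g : SCCLin (expCarrier P) K, ∀ z, i (g.map z) = z.1 := by
  let := rangePosCone i hi
  refine ⟨(rangeLin i hi).comp (expInclLin (ExpSub.ofInjective hK i hi cont le f hf)),
    fun z => ?_⟩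
  exact congrArg Subtype.val ((LinearEquiv.ofInjective i hi).apply_symm_apply
    (expIncl (ExpSub.ofInjective hK i hi cont le f hf) z))

end Subobjects

/-! ### The universal property of promotion. -/

section Universal

variable {P : Type u} [AddCommMonoid P] [Module ℝ≥0 P] [PosCone P]
  {Q : Type v} [AddCommMonoid Q] [Module ℝ≥0 Q] [PosCone Q]

/-- Morphisms from the exponential are determined by their values at promotions. -/
theorem eq_of_promFun_eq (hQ : IsSeparatedCone Q) (f g : SCCLin (expCarrier P) Q)
    (hfg : ∀ x : Ball P, f.map (promFun x) = g.map (promFun x)) (z : expCarrier P) :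
    f.map z = g.map z := by
  -- Composing with the whole dual of `Q` reduces the equalizer of `f` and `g` to one of
  -- functionals.
  let a : Dual Q → Dual (expCarrier P) := fun y => y.comp f
  let b : Dual Q → Dual (expCarrier P) := fun y => y.comp g
  let j := equalizerIncl exp_complete a b
  let p : Ball P → equalizer a b := fun x =>
    ⟨promFun x, fun y => congrArg y.map (hfg x)⟩
  obtain ⟨k, hk⟩ := exists_lift_of_injective (P := P) (K := equalizer a b)
    (equalizer_complete exp_complete) ((expCarrier P).subtype ∘ₗ j.map)
    (Subtype.val_injective.comp Subtype.val_injective)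
    (fun h => ((expCoord h).comp j).cont)
    (fun h z => ((ExpSub.top P).coord_le h (expIncl _ z.1)).trans (nrm_expIncl_le _ _))
    { map := p, stable := isStable_equalizer promFun_stable, nrm_le := nrm_promFun_le }
    (fun _ => rfl)
  -- `k` preserves the underlying family, so `z` itself lies in the equalizer.
  have hz : (k.map z).1 = z := Subtype.ext (hk z)
  exact hQ _ _ fun y => hz ▸ (k.map z).2 y

/-- A coordinate of the product cone, as an element of its dual. -/
noncomputable def bddCoord (h : SCCStab P ℝ≥0) : Dual (bddSub P) where
  map := (LinearMap.proj h : (SCCStab P ℝ≥0 → ℝ≥0) →ₗ[ℝ≥0] ℝ≥0) ∘ₗ (bddSub P).subtype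
  cont := (ExpSub.top P).coord_cont h

/-- A morphism to `ℝ≥0`, as an element of the dual. -/
def SCCLin.toDual (f : SCCLin Q ℝ≥0) : Dual Q where
  map := f.map
  cont := f.cont

/-- Stable functions extend along promotion to morphisms from the exponential. -/
theorem exists_extension (hQ : IsCompleteCone Q) (hQ' : IsSeparatedCone Q) (g : SCCStab P Q) :
    ∃ f : SCCLin (expCarrier P) Q, ∀ x : Ball P, f.map (promFun x) = g.map x := by
  have hB : IsCompleteCone (bddSub P) := (ExpSub.top P).complete
  let π₁ : SCCLin (bddSub P × Q) (bddSub P) := prodFst hB hQ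
  let π₂ : SCCLin (bddSub P × Q) Q := prodSnd hB hQ
  -- These equations cut out the pairs `(z, q)` in which `q` has the values prescribed by the
  -- coordinates `y ∘ g` of `z`.
  let a : SCCLin Q ℝ≥0 → Dual (bddSub P × Q) := fun y => (bddCoord (y.compStab g)).comp π₁
  let b : SCCLin Q ℝ≥0 → Dual (bddSub P × Q) := fun y => y.toDual.comp π₂
  let j := equalizerIncl (prod_complete hB hQ) a b
  let ev : Ball P → bddSub P := fun x => ⟨evalFamily P x, (ExpSub.top P).eval_mem x⟩
  let e : Ball P → equalizer a b := fun x => ⟨(ev x, g.map x), fun _ => rfl⟩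
  have hinj : Function.Injective ((bddSub P).subtype ∘ₗ π₁.map ∘ₗ j.map) := by
    intro x y hxy
    have h₁ : x.1.1 = y.1.1 := Subtype.ext hxy
    refine Subtype.ext (Prod.ext h₁ (eq_of_forall_sccLin hQ hQ' fun q => ?_))
    exact (x.2 q).symm.trans ((congrArg (fun w : bddSub P => w.1 (q.compStab g)) h₁).trans (y.2 q))
  obtain ⟨k, hk⟩ := exists_lift_of_injective (P := P) (K := equalizer a b)
    (equalizer_complete (prod_complete hB hQ)) _ hinj
    (fun h => ((bddCoord h).comp (π₁.comp j)).cont)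
    (fun h z => ((ExpSub.top P).coord_le h z.1.1).trans (le_max_left _ _))
    { map := e
      stable := isStable_equalizer (isStable_prod (ExpSub.top P).eval_stable g.stable)
      nrm_le := fun x => max_le ((ExpSub.top P).eval_le x) (g.nrm_le x) }
    (fun _ => rfl)
  refine ⟨(π₂.comp j).comp k, fun x => ?_⟩
  -- Both sides have the family `evalFamily P x` as first component, and the first component is
  -- injective.
  have : k.map (promFun x) = e x := hinj (hk (promFun x))
  exact congrArg (fun w : equalizer a b => w.1.2) this

end Universal

theorem expTranspose_bijective (P : SCC.{u}) (Q : SCC.{v}) :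
    Function.Bijective (expTranspose P Q) := by
  constructor
  · intro f g hfg
    have h : f.map = g.map := LinearMap.ext (eq_of_promFun_eq Q.separated f g fun x =>
      congrFun (congrArg SCCStab.map hfg) x)
    cases f
    cases g
    cases h
    rfl
  · intro g
    obtain ⟨f, hf⟩ := exists_extension Q.complete Q.separated g
    refine ⟨f, ?_⟩
    have h : (expTranspose P Q f).map = g.map := funext hf
    -- With a variable in place of the transpose, `cases` can reduce equality of structures to
    -- equality of their maps.
    generalize expTranspose P Q f = g' at h
    cases g
    cases g'
    cases h
    rfl

/-! ### Measurability of the transpose. -/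

section Measurable

variable {C : Type u₁} [Category.{v₁} C] {ρ : C ⥤ MeasCat.{w₁}}

theorem isMeasStab_prom (P : MCone.{u} ρ) : IsMeasStab P P.exp (prom P.cone) :=
  fun p γ hγ _ _ hm => hm.2 p γ hγ

/-- From left to right, `m ∘ f` is a test of `!P` for each test `m` of `Q`: pointwise measurability
comes from `m`, and joint measurability along promoted paths is the hypothesis. From right to left,
promotion sends measurable paths to measurable paths. -/
theorem isMeasStab_expTranspose_iff (P : MCone.{u} ρ) (Q : MCone.{v} ρ)
    (f : SCCLin P.exp.cone Q.cone) :
    IsMeasStab P Q (expTranspose P.cone Q.cone f) ↔ IsMeasLin P.exp Q f :=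
  ⟨fun h _ _ hδ q m hm => hδ q (fun s => (m s).comp f)
      ⟨fun z => Q.measurable_test q m hm (f.map z), fun p' γ hγ => h p' γ hγ q m hm⟩,
    fun h p γ hγ => h p _ (isMeasStab_prom P p γ hγ)⟩

end Measurable

end MeasCones

theorem mainTheorem10 {C : Type u₁} [Category.{v₁} C]
    [Limits.HasFiniteProducts C] (ρ : C ⥤ MeasCat.{w₁}) [Limits.PreservesFiniteProducts ρ]
    (P : MeasCones.MCone.{u} ρ) (Q : MeasCones.MCone.{v} ρ) :
    Function.Bijective (MeasCones.expTranspose P.cone Q.cone) ∧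
      Set.BijOn (MeasCones.expTranspose P.cone Q.cone)
        {f : MeasCones.SCCLin P.exp.cone Q.cone | MeasCones.IsMeasLin P.exp Q f}
        {g : MeasCones.SCCStab P.cone Q.cone | MeasCones.IsMeasStab P Q g} := by
  have hb := MeasCones.expTranspose_bijective P.cone Q.cone
  refine ⟨hb, fun f hf => (MeasCones.isMeasStab_expTranspose_iff P Q f).2 hf,
    hb.1.injOn, fun g hg => ?_⟩
  obtain ⟨f, rfl⟩ := hb.2 g
  exact ⟨f, (MeasCones.isMeasStab_expTranspose_iff P Q f).1 hg, rfl⟩
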